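/- **Conventions.** Work in $\mathsf{RCA}_0$: the theory in the language of second-order arithmetic saying that $\mathbb N$ is a discretely ordered commutative semiring with identity, together with the $\Sigma^0_1$ induction scheme and the $\Delta^0_1$ comprehension scheme. Ordered pairs are coded by $\langle i,j\rangle=(i+j)^2+i$, functions and binary relations are sets of coded pairs, and a set is finite if it is bounded. A quasi-order is a reflexive and transitive relation $\le_Q$ on a set $Q$, and a partial order is an antisymmetric quasi-order. Write $y<_Qz$ for $y\le_Q z\wedge z\nleq_Q y$, and $y\mid_Q z$ for $y\nleq_Q z\wedge z\nleq_Q y$. A wqo is a quasi-order $Q$ such that for every function $q\colon\mathbb N\to Q$ there are $m<n$ with $q(m)\le_Q q(n)$. Let $f\colon\mathbb N\to\mathbb N$ be an injection, $P$ a finite partial order and $x\in P$. For $s\in\mathbb N$ let $$T_s=\{n<s : \forall k\,(n<k\le s\rightarrow f(n)<f(k))\}.$$ Let $P_n=\{n\}\times P$ and $x_n=(n,x)$. The structure $Q=\Xi_f(P,x)$ has domain $\bigcup_{n\in\mathbb N}P_n$; on each $P_n$ the relation $\le_Q$ is the copy of $\le_P$; and for each $s$ the elements of $P_{s+1}$ are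 related to the elements of $\bigcup_{n\le s}P_n$ as follows. * If $T_{s+1}\subsetneq T_s\cup\{s\}$, let $n_0$ be the least element of $(T_s\cup\{s\})\setminus T_{s+1}$. Every $z\in P_{s+1}$ is (strictly) above all $y\in\bigcup_{n\le s}P_n$ with $y\le_Q x_{n_0}$, (strictly) below all such $y$ with $y>_Q x_{n_0}$, and incomparable with all such $y$ with $y\mid_Q x_{n_0}$. * If $T_{s+1}=T_s\cup\{s\}$, every $z\in P_{s+1}$ is (strictly) above all $y\in\bigcup_{n\le s}P_n$ with $y<_Q x_s$, (strictly) below all such $y$ with $y\ge_Q x_s$, and incomparable with all such $y$ with $y\mid_Q x_s$. **Lemma.** The following is provable in $\mathsf{RCA}_0$, that is, holds in every model of $\mathsf{RCA}_0$. For every injection $f\colon\mathbb N\to\mathbb N$, every finite partial order $P$ and every $x\in P$, the structure $Q=\Xi_f(P,x)$ exists, is uniquely determined by the clauses above, and is a partial order; and if $Q$ is not a wqo, then the range of $f$ exists, i.e. there is a set $X$ such that $\forall n\,(n\in X\leftrightarrow\exists m\,(f(m)=n))$. -/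

import Mathlib

/-! Second-order arithmetic and its subsystem `RCA₀`, treated through its (general, possibly
nonstandard) models. A structure for the language of second-order arithmetic is a first-order part
`M`, together with a collection `S : Set (Set M)` over which the set variables range. -/

namespace SOA

/-! ### Bounded-quantifier formulas -/

/-- Number terms. Number variables are de Bruijn indices. -/
inductive Term : Type
  | var (i : ℕ) : Term
  | zero : Term
  | one : Term
  | add (s t : Term) : Term
  | mul (s t : Term) : Term

/-- `Σ⁰₀` formulas (all quantifiers bounded), with number variables and set variables indexed
by `ℕ`. The remaining connectives and `∃ v < t` are expressible through negation. -/
inductive BddFormula : Type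
  | eq (s t : Term) : BddFormula
  | lt (s t : Term) : BddFormula
  | mem (t : Term) (i : ℕ) : BddFormula
  | neg (φ : BddFormula) : BddFormula
  | and (φ ψ : BddFormula) : BddFormula
  /-- `all t φ` is `∀ v < t, φ`; variable `0` of `φ` is `v`, and `t` does not mention `v`. -/
  | all (t : Term) (φ : BddFormula) : BddFormula

/-- Prepend a value to an assignment of the number variables. -/
def push {M : Type*} (a : M) (e : ℕ → M) : ℕ → M
  | 0 => a
  | n + 1 => e n

section

variable {M : Type*} [CommSemiring M]

def Term.eval (e : ℕ → M) : Term → M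
  | .var i => e i
  | .zero => 0
  | .one => 1
  | .add s t => s.eval e + t.eval e
  | .mul s t => s.eval e * t.eval e

/-- Satisfaction, under the assignment `V` of set variables and `e` of number variables. -/
def BddFormula.Sat [LinearOrder M] (V : ℕ → Set M) : (ℕ → M) → BddFormula → Prop
  | e, .eq s t => s.eval e = t.eval e
  | e, .lt s t => s.eval e < t.eval e
  | e, .mem t i => t.eval e ∈ V i
  | e, .neg φ => ¬ φ.Sat V e
  | e, .and φ ψ => φ.Sat V e ∧ ψ.Sat V e
  | e, .all t φ => ∀ a : M, a < t.eval e → φ.Sat V (push a e)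

/-- The property of `n` given by the `Σ⁰₁` formula `∃ m, θ(m, n)` with number parameters `e` and
set parameters `V`. -/
def SigmaOne [LinearOrder M] (θ : BddFormula) (V : ℕ → Set M) (e : ℕ → M) (n : M) : Prop :=
  ∃ m : M, θ.Sat V (push m (push n e))

/-- The property of `n` given by the `Π⁰₁` formula `∀ m, θ(m, n)` with number parameters `e` and
set parameters `V`. -/
def PiOne [LinearOrder M] (θ : BddFormula) (V : ℕ → Set M) (e : ℕ → M) (n : M) : Prop :=
  ∀ m : M, θ.Sat V (push m (push n e))

end

/-- `(M, S)` is a model of `RCA₀`: `M` is a discretely ordered commutative semiring with identity,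
and `(M, S)` satisfies the `Σ⁰₁` induction scheme and the `Δ⁰₁` comprehension scheme, with
parameters from `M` and `S`. -/
structure ModelsRCA0 {M : Type*} [CommSemiring M] [LinearOrder M] [IsStrictOrderedRing M]
    (S : Set (Set M)) : Prop where
  nonempty : S.Nonempty
  nonneg : ∀ a : M, 0 ≤ a
  discrete : ∀ a b : M, a < b ↔ a + 1 ≤ b
  induction : ∀ (θ : BddFormula) (V : ℕ → Set M) (e : ℕ → M), (∀ i, V i ∈ S) →
    SigmaOne θ V e 0 → (∀ n, SigmaOne θ V e n → SigmaOne θ V e (n + 1)) →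
    ∀ n, SigmaOne θ V e n
  comprehension : ∀ (θ η : BddFormula) (V : ℕ → Set M) (e : ℕ → M), (∀ i, V i ∈ S) →
    (∀ n, SigmaOne θ V e n ↔ PiOne η V e n) → {n | SigmaOne θ V e n} ∈ S

/-! ### Functions, relations and orders inside a model -/

section

variable {M : Type*} [CommSemiring M]

/-- The usual code of an ordered pair of numbers. -/
def pair (a b : M) : M := (a + b) ^ 2 + a

/-- `f` is (given by) a function `ℕ → ℕ` of the model: its graph is a set of the model. -/
def IsFunction (S : Set (Set M)) (f : M → M) : Prop :=
  {z | ∃ n, z = pair n (f n)} ∈ S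

/-- `r` is (given by) a binary relation of the model. -/
def IsRelation (S : Set (Set M)) (r : M → M → Prop) : Prop :=
  {z | ∃ a b, r a b ∧ z = pair a b} ∈ S

/-- Finiteness of a set, in the sense of the model. -/
def IsFinite [LinearOrder M] (X : Set M) : Prop := ∃ k : M, ∀ i ∈ X, i < k

/-- `(Q, le)` is a quasi-order of the model `(M, S)`. -/
structure IsQuasiOrder (S : Set (Set M)) (Q : Set M) (le : M → M → Prop) : Prop where
  mem : Q ∈ S
  isRelation : IsRelation S le
  supp : ∀ a b, le a b → a ∈ Q ∧ b ∈ Q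
  refl : ∀ a ∈ Q, le a a
  trans : ∀ a b c, le a b → le b c → le a c

/-- `(Q, le)` is a partial order of the model `(M, S)`. -/
structure IsPartialOrder (S : Set (Set M)) (Q : Set M) (le : M → M → Prop) : Prop
    extends IsQuasiOrder S Q le where
  antisymm : ∀ a b, le a b → le b a → a = b

/-- `(Q, le)` is a well-quasi-order in the sense of the model `(M, S)`: a quasi-order such that no
sequence of the model is bad. -/
def IsWQO [LinearOrder M] (S : Set (Set M)) (Q : Set M) (le : M → M → Prop) : Prop :=
  IsQuasiOrder S Q le ∧
    ∀ q : M → M, IsFunction S q → (∀ n, q n ∈ Q) → ∃ m n, m < n ∧ le (q m) (q n)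

end

/-! ### The order `Ξ_f(P, x)` -/

section

variable {M : Type*}

/-- Strictly below. -/
def Lt (le : M → M → Prop) (a b : M) : Prop := le a b ∧ ¬ le b a

/-- Incomparable. -/
def Incomp (le : M → M → Prop) (a b : M) : Prop := ¬ le a b ∧ ¬ le b a

/-- With respect to `D`, the elements of `Z` are placed immediately above `w`. -/
def PlacedAbove (le : M → M → Prop) (D Z : Set M) (w : M) : Prop :=
  ∀ y ∈ D, ∀ z ∈ Z,
    (le y w → Lt le y z) ∧ (Lt le w y → Lt le z y) ∧ (Incomp le y w → Incomp le y z)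

/-- With respect to `D`, the elements of `Z` are placed immediately below `w`. -/
def PlacedBelow (le : M → M → Prop) (D Z : Set M) (w : M) : Prop :=
  ∀ y ∈ D, ∀ z ∈ Z,
    (Lt le y w → Lt le y z) ∧ (le w y → Lt le z y) ∧ (Incomp le y w → Incomp le y z)

variable [CommSemiring M] [LinearOrder M]

/-- `T_s`: the set of all `n < s` that are `f`-true at stage `s`. -/
def trueAt (f : M → M) (s : M) : Set M :=
  {n | n < s ∧ ∀ k, n < k → k ≤ s → f n < f k}

/-- `P_n`: the `n`-th copy of `P`. -/
def copy (P : Set M) (n : M) : Set M := {z | ∃ p ∈ P, z = pair n p}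

/-- The union of the copies `P_n` with `n ≤ s`. -/
def copiesUpTo (P : Set M) (s : M) : Set M := {z | ∃ n, n ≤ s ∧ z ∈ copy P n}

/-- `(Q, leQ)` is the structure `Ξ_f(P, x)` as constructed in the model `(M, S)`. -/
structure IsXi (S : Set (Set M)) (f : M → M) (P : Set M) (leP : M → M → Prop) (x : M)
    (Q : Set M) (leQ : M → M → Prop) : Prop where
  mem : Q ∈ S
  isRelation : IsRelation S leQ
  supp : ∀ a b, leQ a b → a ∈ Q ∧ b ∈ Q
  domain : ∀ z, z ∈ Q ↔ ∃ n, z ∈ copy P n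
  /-- On each copy of `P` the order is that of `P`. -/
  onCopy : ∀ n, ∀ p ∈ P, ∀ p' ∈ P, (leQ (pair n p) (pair n p') ↔ leP p p')
  /-- Stage `s + 1`, first case. -/
  above : ∀ s n₀, trueAt f (s + 1) ⊂ trueAt f s ∪ {s} →
    IsLeast ((trueAt f s ∪ {s}) \ trueAt f (s + 1)) n₀ →
    PlacedAbove leQ (copiesUpTo P s) (copy P (s + 1)) (pair n₀ x)
  /-- Stage `s + 1`, second case. -/
  below : ∀ s, trueAt f (s + 1) = trueAt f s ∪ {s} →
    PlacedBelow leQ (copiesUpTo P s) (copy P (s + 1)) (pair s x)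

end

end SOA

/-!
Each new copy of `P` is placed next to an element that is already present, so it inherits
transitivity, antisymmetry and uniqueness from the earlier copies, by induction on the stage. For
existence, the position of the `n`-th copy relative to an earlier `m`-th copy depends only on
whether `T_m ⊆ T_n` and whether `m ∈ T_n`, which is a bounded condition.

If a number true at stage `m` is false at a later stage `n`, then `T_m ⊈ T_n`, and the whole `m`-th
copy lies below the `n`-th one. A bad sequence is injective, so by the pigeonhole principle it
visits arbitrarily late copies. Hence whatever is true at the index of a visited copy stays true
forever, and the bad sequence enumerates the true numbers. A value below `f a` with `a` true can
only be attained up to `a`; this makes the complement of the range of `f` a `Σ⁰₁` class.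
-/

namespace SOA

/-! ### Definability with parameters -/

/-- Rename the variables of a term. -/
def Term.rename (ρ : ℕ → ℕ) : Term → Term
  | .var i => .var (ρ i)
  | .zero => .zero
  | .one => .one
  | .add s t => .add (s.rename ρ) (t.rename ρ)
  | .mul s t => .mul (s.rename ρ) (t.rename ρ)

/-- Rename the set variables of a formula by `g` and its number variables by `ρ`. -/
def BddFormula.rename (g : ℕ → ℕ) : (ℕ → ℕ) → BddFormula → BddFormula
  | ρ, .eq s t => .eq (s.rename ρ) (t.rename ρ)
  | ρ, .lt s t => .lt (s.rename ρ) (t.rename ρ)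
  | ρ, .mem t i => .mem (t.rename ρ) (g i)
  | ρ, .neg φ => .neg (φ.rename g ρ)
  | ρ, .and φ ψ => .and (φ.rename g ρ) (ψ.rename g ρ)
  | ρ, .all t φ => .all (t.rename ρ) (φ.rename g (push 0 (ρ · + 1)))

/-- The sequence with `u` at the even and `v` at the odd places, used to combine the parameters of
two formulas into one assignment. -/
def merge {α : Type*} (u v : ℕ → α) (i : ℕ) : α := if i % 2 = 0 then u (i / 2) else v (i / 2)

section

variable {α β : Type*}

@[simp]
theorem merge_two_mul (u v : ℕ → α) (i : ℕ) : merge u v (2 * i) = u i := by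
  simp [merge]

@[simp]
theorem merge_two_mul_add_one (u v : ℕ → α) (i : ℕ) : merge u v (2 * i + 1) = v i := by
  simp [merge, show (2 * i + 1) / 2 = i by lia]

theorem merge_mem {p : α → Prop} {u v : ℕ → α} (hu : ∀ i, p (u i)) (hv : ∀ i, p (v i)) (i : ℕ) :
    p (merge u v i) := by
  unfold merge
  split_ifs
  exacts [hu _, hv _]

theorem comp_merge (g : α → β) (u v : ℕ → α) : g ∘ merge u v = merge (g ∘ u) (g ∘ v) :=
  funext fun _ => apply_ite g ..

theorem push_comp_push (a : α) (e : ℕ → α) (ρ : ℕ → ℕ) :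
    push a e ∘ push 0 (ρ · + 1) = push a (e ∘ ρ) :=
  funext fun i => by cases i <;> rfl

theorem exists_common_parameters (c₁ c₂ : ℕ → α) : ∃ (c : ℕ → α) (ρ₁ ρ₂ : ℕ → ℕ),
    ∀ e, merge e c ∘ ρ₁ = merge e c₁ ∧ merge e c ∘ ρ₂ = merge e c₂ := by
  refine ⟨merge c₁ c₂, merge (2 * ·) fun i => 2 * (2 * i) + 1,
    merge (2 * ·) fun i => 2 * (2 * i + 1) + 1, fun e => ?_⟩
  constructor <;> rw [comp_merge] <;> simp [Function.comp_def]

theorem exists_rename_push (c : ℕ → α) : ∃ ρ : ℕ → ℕ,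
    ∀ a e, push a (merge e c) ∘ ρ = merge (push a e) c := by
  refine ⟨merge (push 0 (2 * · + 1)) (2 * · + 1 + 1), fun a e => ?_⟩
  rw [comp_merge, push_comp_push]
  simp [Function.comp_def, push]

end

section

variable {M : Type*} [CommSemiring M]

theorem Term.eval_rename (ρ : ℕ → ℕ) (e : ℕ → M) (t : Term) :
    (t.rename ρ).eval e = t.eval (e ∘ ρ) := by
  induction t <;> simp_all [Term.rename, Term.eval]

theorem BddFormula.sat_rename [LinearOrder M] (V : ℕ → Set M) (g ρ : ℕ → ℕ) (e : ℕ → M)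
    (φ : BddFormula) : (φ.rename g ρ).Sat V e ↔ φ.Sat (V ∘ g) (e ∘ ρ) := by
  induction φ generalizing ρ e <;>
    simp_all [BddFormula.rename, BddFormula.Sat, Term.eval_rename, push_comp_push]

/-- The functions of the assignment that are given by number terms with parameters from `M`. -/
inductive TermDefinable : ((ℕ → M) → M) → Prop
  | var (i : ℕ) : TermDefinable fun e => e i
  | const (c : M) : TermDefinable fun _ => c
  | add {s t : (ℕ → M) → M} :
      TermDefinable s → TermDefinable t → TermDefinable fun e => s e + t e
  | mul {s t : (ℕ → M) → M} :
      TermDefinable s → TermDefinable t → TermDefinable fun e => s e * t e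

variable {s t : (ℕ → M) → M}

theorem TermDefinable.comp (ht : TermDefinable t) (ρ : ℕ → ℕ) :
    TermDefinable fun e => t (e ∘ ρ) := by
  induction ht with
  | var i => exact .var (ρ i)
  | const c => exact .const c
  | add _ _ hs ht => exact .add hs ht
  | mul _ _ hs ht => exact .mul hs ht

theorem TermDefinable.pair (hs : TermDefinable s) (ht : TermDefinable t) :
    TermDefinable fun e => pair (s e) (t e) := by
  simp only [SOA.pair, sq]
  exact ((hs.add ht).mul (hs.add ht)).add hs

theorem TermDefinable.exists_term (ht : TermDefinable t) :
    ∃ (τ : Term) (c : ℕ → M), ∀ e, τ.eval (merge e c) = t e := by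
  induction ht with
  | var i => exact ⟨.var (2 * i), fun _ => 0, fun e => merge_two_mul ..⟩
  | const c => exact ⟨.var (2 * 0 + 1), fun _ => c, fun e => merge_two_mul_add_one ..⟩
  | add _ _ hs ht =>
    obtain ⟨⟨τ₁, c₁, h₁⟩, τ₂, c₂, h₂⟩ := hs, ht
    obtain ⟨c, ρ₁, ρ₂, hc⟩ := exists_common_parameters c₁ c₂
    exact ⟨.add (τ₁.rename ρ₁) (τ₂.rename ρ₂), c, fun e => by
      simp only [Term.eval, Term.eval_rename, hc, h₁, h₂]⟩
  | mul _ _ hs ht =>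
    obtain ⟨⟨τ₁, c₁, h₁⟩, τ₂, c₂, h₂⟩ := hs, ht
    obtain ⟨c, ρ₁, ρ₂, hc⟩ := exists_common_parameters c₁ c₂
    exact ⟨.mul (τ₁.rename ρ₁) (τ₂.rename ρ₂), c, fun e => by
      simp only [Term.eval, Term.eval_rename, hc, h₁, h₂]⟩

theorem TermDefinable.exists_terms (hs : TermDefinable s) (ht : TermDefinable t) :
    ∃ (σ τ : Term) (c : ℕ → M), ∀ e, σ.eval (merge e c) = s e ∧ τ.eval (merge e c) = t e := by
  obtain ⟨⟨σ, c₁, h₁⟩, τ, c₂, h₂⟩ := hs.exists_term, ht.exists_term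
  obtain ⟨c, ρ₁, ρ₂, hc⟩ := exists_common_parameters c₁ c₂
  exact ⟨σ.rename ρ₁, τ.rename ρ₂, c, fun e => by
    simp only [Term.eval_rename, hc, h₁, h₂, and_self]⟩

variable [LinearOrder M] {S : Set (Set M)} {A B : (ℕ → M) → Prop}

/-- The predicates of the assignment that are given by `Σ⁰₀` formulas with parameters from `M`
and `S`. -/
inductive BddDefinable (S : Set (Set M)) : ((ℕ → M) → Prop) → Prop
  | eq {s t : (ℕ → M) → M} :
      TermDefinable s → TermDefinable t → BddDefinable S fun e => s e = t e
  | lt {s t : (ℕ → M) → M} :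
      TermDefinable s → TermDefinable t → BddDefinable S fun e => s e < t e
  | mem {t : (ℕ → M) → M} {X : Set M} :
      X ∈ S → TermDefinable t → BddDefinable S fun e => t e ∈ X
  | not {A : (ℕ → M) → Prop} : BddDefinable S A → BddDefinable S fun e => ¬ A e
  | and {A B : (ℕ → M) → Prop} :
      BddDefinable S A → BddDefinable S B → BddDefinable S fun e => A e ∧ B e
  | all {t : (ℕ → M) → M} {A : (ℕ → M) → Prop} :
      TermDefinable t → BddDefinable S A → BddDefinable S fun e => ∀ a < t e, A (push a e)

namespace BddDefinable

theorem congr (hA : BddDefinable S A) (h : ∀ e, A e ↔ B e) : BddDefinable S B := by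
  rwa [← funext fun e => propext (h e)]

theorem comp (hA : BddDefinable S A) (ρ : ℕ → ℕ) : BddDefinable S fun e => A (e ∘ ρ) := by
  induction hA generalizing ρ with
  | eq hs ht => exact .eq (hs.comp ρ) (ht.comp ρ)
  | lt hs ht => exact .lt (hs.comp ρ) (ht.comp ρ)
  | mem hX ht => exact .mem hX (ht.comp ρ)
  | not _ ih => exact .not (ih ρ)
  | and _ _ ihA ihB => exact .and (ihA ρ) (ihB ρ)
  | all ht _ ih =>
    simp only [← push_comp_push]
    exact .all (ht.comp ρ) (ih (push 0 (ρ · + 1)))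

theorem le (hs : TermDefinable s) (ht : TermDefinable t) : BddDefinable S fun e => s e ≤ t e :=
  (lt ht hs).not.congr fun _ => not_lt

theorem or (hA : BddDefinable S A) (hB : BddDefinable S B) : BddDefinable S fun e => A e ∨ B e :=
  (hA.not.and hB.not).not.congr fun e => by tauto

theorem imp (hA : BddDefinable S A) (hB : BddDefinable S B) : BddDefinable S fun e => A e → B e :=
  (hA.and hB.not).not.congr fun e => by tauto

theorem iff (hA : BddDefinable S A) (hB : BddDefinable S B) : BddDefinable S fun e => A e ↔ B e :=
  ((hA.imp hB).and (hB.imp hA)).congr fun e => by tauto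

theorem ball {A : M → (ℕ → M) → Prop} (ht : TermDefinable t)
    (hA : BddDefinable S fun e => A (e 0) fun i => e (i + 1)) :
    BddDefinable S fun e => ∀ a < t e, A a e :=
  .all ht hA

theorem bex {A : M → (ℕ → M) → Prop} (ht : TermDefinable t)
    (hA : BddDefinable S fun e => A (e 0) fun i => e (i + 1)) :
    BddDefinable S fun e => ∃ a < t e, A a e :=
  (ball (A := fun a e => ¬ A a e) ht hA.not).not.congr fun e => by simp

theorem exists_formula (hA : BddDefinable S A) (hS : S.Nonempty) :
    ∃ (θ : BddFormula) (V : ℕ → Set M) (c : ℕ → M), (∀ i, V i ∈ S) ∧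
      ∀ e, θ.Sat V (merge e c) ↔ A e := by
  obtain ⟨X₀, hX₀⟩ := hS
  induction hA with
  | eq hs ht =>
    obtain ⟨σ, τ, c, h⟩ := hs.exists_terms ht
    exact ⟨.eq σ τ, fun _ => X₀, c, fun _ => hX₀, fun e => by simp only [BddFormula.Sat, h]⟩
  | lt hs ht =>
    obtain ⟨σ, τ, c, h⟩ := hs.exists_terms ht
    exact ⟨.lt σ τ, fun _ => X₀, c, fun _ => hX₀, fun e => by simp only [BddFormula.Sat, h]⟩
  | @mem _ X hX ht =>
    obtain ⟨τ, c, h⟩ := ht.exists_term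
    exact ⟨.mem τ 0, fun _ => X, c, fun _ => hX, fun e => by simp only [BddFormula.Sat, h]⟩
  | not _ ih =>
    obtain ⟨θ, V, c, hV, h⟩ := ih
    exact ⟨.neg θ, V, c, hV, fun e => not_congr (h e)⟩
  | and _ _ ihA ihB =>
    obtain ⟨⟨θ₁, V₁, c₁, hV₁, h₁⟩, θ₂, V₂, c₂, hV₂, h₂⟩ := ihA, ihB
    obtain ⟨c, ρ₁, ρ₂, hc⟩ := exists_common_parameters c₁ c₂
    refine ⟨.and (θ₁.rename (2 * ·) ρ₁) (θ₂.rename (2 * · + 1) ρ₂), merge V₁ V₂, c,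
      merge_mem hV₁ hV₂, fun e => ?_⟩
    simp only [BddFormula.Sat, BddFormula.sat_rename, hc, Function.comp_def, merge_two_mul,
      merge_two_mul_add_one, h₁, h₂]
  | all ht _ ih =>
    obtain ⟨⟨τ, c₁, h₁⟩, θ, V, c₂, hV, h₂⟩ := ht.exists_term, ih
    obtain ⟨c, ρ₁, ρ₂, hc⟩ := exists_common_parameters c₁ c₂
    obtain ⟨ρ, hρ⟩ := exists_rename_push c₂
    refine ⟨.all (τ.rename ρ₁) ((θ.rename id ρ).rename id (push 0 (ρ₂ · + 1))), V, c, hV,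
      fun e => ?_⟩
    simp only [BddFormula.Sat, BddFormula.sat_rename, Term.eval_rename, push_comp_push, hc, hρ,
      Function.comp_id, h₁, h₂]

theorem exists_formula_push (hA : BddDefinable S A) (hS : S.Nonempty) :
    ∃ (θ : BddFormula) (V : ℕ → Set M) (c : ℕ → M), (∀ i, V i ∈ S) ∧
      ∀ m n, θ.Sat V (push m (push n c)) ↔ A (push m fun _ => n) := by
  obtain ⟨θ, V, c, hV, h⟩ := hA.exists_formula hS
  refine ⟨θ.rename id (merge (push 0 fun _ => 1) (· + 2)), V, c, hV, fun m n => ?_⟩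
  have hvar : push m (push n c) ∘ merge (push 0 fun _ => 1) (· + 2) =
      merge (push m fun _ => n) c := by
    rw [comp_merge, push_comp_push m (push n c) fun _ => 0]
    rfl
  rw [BddFormula.sat_rename, hvar, Function.comp_id, h]

end BddDefinable

/-- The predicates of the assignment that are given by `Σ⁰₁` formulas with parameters from `M`
and `S`. -/
def SigmaDefinable (S : Set (Set M)) (A : (ℕ → M) → Prop) : Prop :=
  ∃ B, BddDefinable S B ∧ ∀ e, A e ↔ ∃ m, B (push m e)

namespace SigmaDefinable

theorem congr (hA : SigmaDefinable S A) (h : ∀ e, A e ↔ B e) : SigmaDefinable S B := by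
  rwa [← funext fun e => propext (h e)]

theorem of_bdd (hA : BddDefinable S A) : SigmaDefinable S A :=
  ⟨_, hA.comp (· + 1), fun _ => ⟨fun h => ⟨0, h⟩, fun ⟨_, h⟩ => h⟩⟩

theorem comp (hA : SigmaDefinable S A) (ρ : ℕ → ℕ) : SigmaDefinable S fun e => A (e ∘ ρ) := by
  obtain ⟨A', hA', h⟩ := hA
  exact ⟨_, hA'.comp (push 0 (ρ · + 1)), fun e => by simp only [push_comp_push, h]⟩

theorem and_bdd (hA : SigmaDefinable S A) (hB : BddDefinable S B) :
    SigmaDefinable S fun e => A e ∧ B e := by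
  obtain ⟨A', hA', h⟩ := hA
  exact ⟨_, hA'.and (hB.comp (· + 1)), fun e =>
    (and_congr_left' (h e)).trans exists_and_right.symm⟩

theorem or (hA : SigmaDefinable S A) (hB : SigmaDefinable S B) :
    SigmaDefinable S fun e => A e ∨ B e := by
  obtain ⟨⟨A', hA', h⟩, B', hB', h'⟩ := hA, hB
  exact ⟨_, hA'.or hB', fun e => (or_congr (h e) (h' e)).trans exists_or.symm⟩

theorem ex [IsStrictOrderedRing M] {A : M → (ℕ → M) → Prop}
    (hA : SigmaDefinable S fun e => A (e 0) fun i => e (i + 1)) :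
    SigmaDefinable S fun e => ∃ a, A a e := by
  obtain ⟨B, hB, h⟩ := hA
  replace h : ∀ a e, A a e ↔ ∃ m, B (push m (push a e)) := fun a e => h (push a e)
  -- A common strict bound for both witnesses turns the two quantifiers into one.
  refine ⟨fun e => ∃ a < e 0, ∃ m < e 0, B (push m (push a fun i => e (i + 1))), ?_, fun e => ?_⟩
  · refine .bex (A := fun a e => ∃ m < e 0, B (push m (push a fun i => e (i + 1)))) (.var 0) <|
      .bex (A := fun m e => B (push m (push (e 0) fun i => e (i + 2)))) (.var 1) <|
      (hB.comp fun | 0 => 0 | 1 => 1 | i + 2 => i + 3).congr fun e => ?_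
    refine iff_of_eq (congrArg B (funext fun i => ?_))
    rcases i with _ | _ | i <;> rfl
  · simp only [h]
    refine ⟨fun ⟨a, m, hm⟩ => ⟨max a m + 1, a, ?_, m, ?_, hm⟩,
      fun ⟨_, a, _, m, _, hm⟩ => ⟨a, m, hm⟩⟩
    exacts [(le_max_left a m).trans_lt (lt_add_one _), (le_max_right a m).trans_lt (lt_add_one _)]

end SigmaDefinable

variable [IsStrictOrderedRing M]

theorem ModelsRCA0.induct (hS : ModelsRCA0 S) {A : M → Prop}
    (hA : SigmaDefinable S fun e => A (e 0)) (zero : A 0) (succ : ∀ n, A n → A (n + 1)) (n : M) :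
    A n := by
  obtain ⟨B, hB, h⟩ := hA
  obtain ⟨θ, V, c, hV, hθ⟩ := hB.exists_formula_push hS.nonempty
  have hSigma (n : M) : SigmaOne θ V c n ↔ A n :=
    (exists_congr fun m => hθ m n).trans (h fun _ => n).symm
  have hind := hS.induction θ V c hV
  simp only [hSigma] at hind
  exact hind zero succ n

theorem ModelsRCA0.mem_of_sigmaDefinable (hS : ModelsRCA0 S) {A : M → Prop}
    (hA : SigmaDefinable S fun e => A (e 0)) (hA' : SigmaDefinable S fun e => ¬ A (e 0)) :
    {n | A n} ∈ S := by
  obtain ⟨⟨B, hB, h⟩, B', hB', h'⟩ := hA, hA'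
  obtain ⟨θ, V, c, hV, hθ⟩ := hB.exists_formula_push hS.nonempty
  obtain ⟨θ', V', c', hV', hθ'⟩ := hB'.exists_formula_push hS.nonempty
  have hpush (g : ℕ → ℕ) (m n : M) : push m (push n (merge c c')) ∘
      push 0 (fun i => push 0 (fun i => g i + 1) i + 1) = push m (push n (merge c c' ∘ g)) := by
    rw [push_comp_push, push_comp_push]
  have hSigma (n : M) : SigmaOne
      (θ.rename (2 * ·) (push 0 fun i => push 0 (fun i => 2 * i + 1) i + 1))
      (merge V V') (merge c c') n ↔ A n := by
    refine .trans (exists_congr fun m => ?_) (h fun _ => n).symm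
    simpa [BddFormula.sat_rename, hpush, Function.comp_def] using hθ m n
  have hPi (n : M) : PiOne
      (.neg (θ'.rename (2 * · + 1) (push 0 fun i => push 0 (fun i => 2 * i + 1 + 1) i + 1)))
      (merge V V') (merge c c') n ↔ A n := by
    refine .trans ?_ (not_congr (h' fun _ => n) |>.symm.trans not_not)
    refine .trans (forall_congr' fun m => not_congr ?_) not_exists.symm
    simpa [BddFormula.sat_rename, hpush, Function.comp_def] using hθ' m n
  simpa only [hSigma] using
    hS.comprehension _ _ _ _ (merge_mem hV hV') fun n => (hSigma n).trans (hPi n).symm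

theorem ModelsRCA0.mem_of_bddDefinable (hS : ModelsRCA0 S) {A : M → Prop}
    (hA : BddDefinable S fun e => A (e 0)) : {n | A n} ∈ S :=
  hS.mem_of_sigmaDefinable (.of_bdd hA) (.of_bdd hA.not)

end

end SOA

namespace SOA

variable {M : Type*} [CommSemiring M] [LinearOrder M] [IsStrictOrderedRing M] {S : Set (Set M)}

/-! ### Arithmetic in models of `RCA₀` -/

theorem ModelsRCA0.lt_add_one_iff (hS : ModelsRCA0 S) {a b : M} : a < b + 1 ↔ a ≤ b := by
  rw [hS.discrete, add_le_add_iff_right]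

theorem ModelsRCA0.one_le (hS : ModelsRCA0 S) {a : M} (ha : 0 < a) : 1 ≤ a := by
  simpa using (hS.discrete _ _).1 ha

theorem ModelsRCA0.dvd_iff_exists_le (hS : ModelsRCA0 S) {a b : M} :
    a ∣ b ↔ ∃ c ≤ b, b = a * c := by
  refine ⟨?_, fun ⟨c, _, hc⟩ => ⟨c, hc⟩⟩
  rintro ⟨c, rfl⟩
  rcases (hS.nonneg a).eq_or_lt with rfl | ha
  · exact ⟨0, by simp, by simp⟩
  · exact ⟨c, le_mul_of_one_le_left (hS.nonneg c) (hS.one_le ha), rfl⟩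

namespace BddDefinable

variable {s t : (ℕ → M) → M} {A : M → (ℕ → M) → Prop}

theorem ball_le (hS : ModelsRCA0 S) (ht : TermDefinable t)
    (hA : BddDefinable S fun e => A (e 0) fun i => e (i + 1)) :
    BddDefinable S fun e => ∀ a ≤ t e, A a e := by
  simp only [← hS.lt_add_one_iff]
  exact .ball (ht.add (.const 1)) hA

theorem bex_le (hS : ModelsRCA0 S) (ht : TermDefinable t)
    (hA : BddDefinable S fun e => A (e 0) fun i => e (i + 1)) :
    BddDefinable S fun e => ∃ a ≤ t e, A a e := by
  simp only [← hS.lt_add_one_iff]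
  exact .bex (ht.add (.const 1)) hA

theorem dvd (hS : ModelsRCA0 S) (hs : TermDefinable s) (ht : TermDefinable t) :
    BddDefinable S fun e => s e ∣ t e := by
  simp only [hS.dvd_iff_exists_le]
  exact .bex_le hS ht (.eq (ht.comp (· + 1)) ((hs.comp (· + 1)).mul (.var 0)))

/- The content is in the default proof of `hA`: it takes `A` apart along the closure properties
above and uses the hypotheses in the context for everything else. -/
omit [IsStrictOrderedRing M] in
theorem auto {A : (ℕ → M) → Prop} (hA : BddDefinable S A := by
    beta_reduce
    with_reducible repeat' first
      | apply_assumption -exfalso -symm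
      | apply BddDefinable.ball
      | apply BddDefinable.bex
      | apply BddDefinable.ball_le
      | apply BddDefinable.bex_le
      | apply BddDefinable.eq
      | apply BddDefinable.lt
      | apply BddDefinable.le
      | apply BddDefinable.dvd
      | apply BddDefinable.mem
      | apply BddDefinable.not
      | apply BddDefinable.and
      | apply BddDefinable.or
      | apply BddDefinable.imp
      | apply BddDefinable.iff
      | apply TermDefinable.var
      | apply TermDefinable.const
      | apply TermDefinable.add
      | apply TermDefinable.mul
      | apply TermDefinable.pair) : BddDefinable S A := hA

end BddDefinable

namespace ModelsRCA0

theorem pair_lt_sq (hS : ModelsRCA0 S) {a b c : M} (h : a + b < c) : pair a b < c ^ 2 := by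
  calc (a + b) ^ 2 + a < (a + b) ^ 2 + a + (a + b + b + 1) :=
        lt_add_of_pos_right _ <| hS.lt_add_one_iff.2 <|
          add_nonneg (add_nonneg (hS.nonneg a) (hS.nonneg b)) (hS.nonneg b)
    _ = (a + b + 1) ^ 2 := by ring
    _ ≤ c ^ 2 := pow_le_pow_left₀ (hS.nonneg _) ((hS.discrete _ _).1 h) 2

theorem pair_inj (hS : ModelsRCA0 S) {a b c d : M} : pair a b = pair c d ↔ a = c ∧ b = d := by
  refine ⟨fun h => ?_, fun h => by rw [h.1, h.2]⟩
  have pair_lt_pair {a b c d : M} (h : a + b < c + d) : pair a b < pair c d :=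
    (hS.pair_lt_sq h).trans_le (le_add_of_nonneg_right (hS.nonneg c))
  have hsum : a + b = c + d :=
    le_antisymm (not_lt.1 fun h' => (pair_lt_pair h').ne' h)
      (not_lt.1 fun h' => (pair_lt_pair h').ne h)
  obtain rfl : a = c := by simpa [pair, hsum] using h
  exact ⟨rfl, add_left_cancel hsum⟩

theorem left_le_pair (hS : ModelsRCA0 S) (a b : M) : a ≤ pair a b :=
  le_add_of_nonneg_left (pow_nonneg (hS.nonneg _) _)

theorem le_sq (hS : ModelsRCA0 S) (a : M) : a ≤ a ^ 2 := by
  rcases (hS.nonneg a).eq_or_lt with rfl | ha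
  · simp
  · exact le_self_pow₀ (hS.one_le ha) two_ne_zero

theorem right_le_pair (hS : ModelsRCA0 S) (a b : M) : b ≤ pair a b :=
  calc b ≤ a + b := le_add_of_nonneg_left (hS.nonneg a)
    _ ≤ (a + b) ^ 2 := hS.le_sq _
    _ ≤ (a + b) ^ 2 + a := le_add_of_nonneg_right (hS.nonneg a)

theorem pair_le_pair (hS : ModelsRCA0 S) {a b c d : M} (h : a ≤ c) (h' : b ≤ d) :
    pair a b ≤ pair c d :=
  add_le_add (pow_le_pow_left₀ (hS.nonneg _) (add_le_add h h') 2) h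

theorem lt_or_exists_eq_add (hS : ModelsRCA0 S) (a b : M) : b < a ∨ ∃ c, b = a + c := by
  induction b using hS.induct with
  | hA => exact .or (.of_bdd .auto) (.ex <| .of_bdd .auto)
  | zero =>
    rcases (hS.nonneg a).eq_or_lt with rfl | ha
    exacts [.inr ⟨0, (add_zero 0).symm⟩, .inl ha]
  | succ b ih =>
    rcases ih with hb | ⟨c, rfl⟩
    · rcases ((hS.discrete _ _).1 hb).lt_or_eq with hb | rfl
      exacts [.inl hb, .inr ⟨0, (add_zero _).symm⟩]
    · exact .inr ⟨c + 1, add_assoc ..⟩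

theorem exists_eq_add_of_le (hS : ModelsRCA0 S) {a b : M} (h : a ≤ b) : ∃ c, b = a + c :=
  (hS.lt_or_exists_eq_add a b).resolve_left h.not_gt

theorem exists_isLeast (hS : ModelsRCA0 S) {A : M → Prop}
    (hA : SigmaDefinable S fun e => A (e 0)) (h : ∃ n, A n) : ∃ n, IsLeast {n | A n} n := by
  by_contra! hdesc
  obtain ⟨n, hn⟩ := h
  have hsub (k : M) : ∃ v, A v ∧ v + k ≤ n := by
    induction k using hS.induct with
    | hA => exact .ex <| hA.and_bdd .auto
    | zero => exact ⟨n, hn, (add_zero n).le⟩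
    | succ k ih =>
      obtain ⟨v, hv, hk⟩ := ih
      obtain ⟨w, hw, hwv⟩ : ∃ w, A w ∧ w < v := by
        simpa [IsLeast, lowerBounds, hv] using hdesc v
      refine ⟨w, hw, ?_⟩
      calc w + (k + 1) = w + 1 + k := by ring
        _ ≤ v + k := by grw [(hS.discrete _ _).1 hwv]
        _ ≤ n := hk
  obtain ⟨v, -, hv⟩ := hsub (n + 1)
  exact hv.not_gt <| (lt_add_one n).trans_le <| le_add_of_nonneg_left (hS.nonneg v)

/-! ### The pigeonhole principle -/

theorem dvd_of_dvd_add (hS : ModelsRCA0 S) {u a c : M} (h : u ∣ a + c) (ha : u ∣ a) : u ∣ c := by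
  obtain ⟨⟨t, ht⟩, s, rfl⟩ := h, ha
  rcases le_total s t with hst | hts
  · obtain ⟨r, rfl⟩ := hS.exists_eq_add_of_le hst
    exact ⟨r, add_left_cancel (ht.trans (mul_add ..))⟩
  · have hc : u * s + c ≤ u * s := ht.trans_le (mul_le_mul_of_nonneg_left hts (hS.nonneg u))
    rw [le_antisymm (add_le_iff_nonpos_right _ |>.1 hc) (hS.nonneg c)]
    exact dvd_zero u

theorem exists_common_multiple (hS : ModelsRCA0 S) {t : M → M}
    (ht : TermDefinable fun e => t (e 0)) (hpos : ∀ j, 0 < t j) (b : M) :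
    ∃ m, 0 < m ∧ ∀ j < b, t j ∣ m := by
  induction b using hS.induct with
  | hA => exact .ex <| .of_bdd .auto
  | zero => exact ⟨1, one_pos, fun j hj => absurd hj (hS.nonneg j).not_gt⟩
  | succ b ih =>
    obtain ⟨m, hm, h⟩ := ih
    refine ⟨t b * m, mul_pos (hpos b) hm, fun j hj => ?_⟩
    rcases (hS.lt_add_one_iff.1 hj).lt_or_eq with hj | rfl
    exacts [(h j hj).mul_left _, dvd_mul_right ..]

theorem one_add_dvd_of_dvd_mul (hS : ModelsRCA0 S) {c d : M} (h : 1 + c ∣ c * d) : 1 + c ∣ d :=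
  hS.dvd_of_dvd_add (a := c * d) ⟨d, by ring⟩ h

/-- The moduli `1 + m (v + 1)` of Gödel's `β` function. For `v < b` they are pairwise coprime as
soon as `m` is divisible by all numbers from `1` to `b`. -/
def modulus (m v : M) : M := 1 + m * (v + 1)

theorem dvd_of_modulus_dvd_mul (hS : ModelsRCA0 S) {b m v w d : M} (hm : ∀ j < b, j + 1 ∣ m)
    (hv : v < b) (hw : w < b) (hvw : v ≠ w) (h : modulus m v ∣ modulus m w * d) :
    modulus m v ∣ d := by
  have exists_diff {a c : M} (hac : a < c) (hc : c < b) : ∃ δ, δ ∣ m ∧ c = a + δ := by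
    obtain ⟨j, rfl⟩ := hS.exists_eq_add_of_le ((hS.discrete _ _).1 hac)
    refine ⟨j + 1, hm j (lt_of_le_of_lt ?_ hc), by ring⟩
    exact le_add_of_nonneg_left (add_nonneg (hS.nonneg a) zero_le_one)
  obtain ⟨δ, ⟨c, rfl⟩, hδ⟩ : ∃ δ, δ ∣ m ∧ modulus m v ∣ m * δ * d := by
    rcases hvw.lt_or_gt with hlt | hlt
    · obtain ⟨δ, hδ, rfl⟩ := exists_diff hlt hw
      refine ⟨δ, hδ, hS.dvd_of_dvd_add (a := modulus m v * d) ?_ (dvd_mul_right ..)⟩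
      convert h using 1
      unfold modulus
      ring
    · obtain ⟨δ, hδ, rfl⟩ := exists_diff hlt hv
      refine ⟨δ, hδ, hS.dvd_of_dvd_add ⟨d, ?_⟩ h⟩
      unfold modulus
      ring
  refine hS.one_add_dvd_of_dvd_mul (hS.one_add_dvd_of_dvd_mul ?_)
  change modulus (δ * c) v ∣ _
  convert hδ.mul_right (c * (v + 1) ^ 2) using 1
  ring

theorem exists_lt_of_modulus_dvd (hS : ModelsRCA0 S) {b m w d : M} (hm₀ : 0 < m)
    (hm : ∀ j < b, j + 1 ∣ m) (hw : w < b) (hd : 0 < d) (hwd : modulus m w ∣ d) :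
    ∃ c < d, 0 < c ∧ ∀ v < b, v ≠ w → modulus m v ∣ d → modulus m v ∣ c := by
  obtain ⟨c, rfl⟩ := hwd
  have hmod : 1 < modulus m w :=
    lt_add_of_pos_right _ (mul_pos hm₀ (hS.lt_add_one_iff.2 (hS.nonneg w)))
  have hc : 0 < c := pos_of_mul_pos_right hd (zero_le_one.trans hmod.le)
  exact ⟨c, lt_mul_of_one_lt_left hc hmod, hc, fun v hv hvw =>
    hS.dvd_of_modulus_dvd_mul hm hv hw hvw⟩

-- From a common multiple of all moduli, divide out the modulus of each value as it is taken: a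
-- map with all values below `b` would give a strictly decreasing infinite sequence.
theorem exists_le_map (hS : ModelsRCA0 S) {g : M → M}
    (hg : BddDefinable S fun e => g (e 0) = e 1) (hinj : Function.Injective g) (b : M) :
    ∃ j, b ≤ g j := by
  by_contra! hlt
  obtain ⟨m, hm₀, hm⟩ := hS.exists_common_multiple (t := (· + 1)) (.add (.var 0) (.const 1))
    (fun j => hS.lt_add_one_iff.2 (hS.nonneg j)) b
  have hmod (v : M) : 0 < modulus m v :=
    add_pos_of_pos_of_nonneg one_pos (mul_nonneg hm₀.le (add_nonneg (hS.nonneg v) zero_le_one))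
  have hmodDef (i : ℕ) : TermDefinable fun e => modulus m (e i) :=
    .add (.const 1) (.mul (.const m) (.add (.var i) (.const 1)))
  obtain ⟨C, hC, hdvd⟩ := hS.exists_common_multiple (hmodDef 0) hmod b
  have hdesc (k : M) : ∃ d, (0 < d ∧ d + k ≤ C) ∧
      ∀ v < b, (∀ j < k, ¬ g j = v) → modulus m v ∣ d := by
    induction k using hS.induct with
    | hA => exact .ex <| .of_bdd .auto
    | zero => exact ⟨C, ⟨hC, (add_zero C).le⟩, fun v hv _ => hdvd v hv⟩
    | succ k ih =>
      obtain ⟨d, ⟨hd, hk⟩, h⟩ := ih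
      obtain ⟨c, hcd, hc, hcdvd⟩ := hS.exists_lt_of_modulus_dvd hm₀ hm (hlt k) hd <|
        h (g k) (hlt k) fun j hj hjk => hj.ne (hinj hjk)
      refine ⟨c, ⟨hc, ?_⟩, fun v hv hfree => hcdvd v hv
        (fun hvk => hfree k (lt_add_one k) hvk.symm)
        (h v hv fun j hj => hfree j (hj.trans (lt_add_one k)))⟩
      calc c + (k + 1) = c + 1 + k := by ring
        _ ≤ d + k := by grw [(hS.discrete _ _).1 hcd]
        _ ≤ C := hk
  obtain ⟨d, ⟨-, hd⟩, -⟩ := hdesc (C + 1)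
  exact hd.not_gt <| (lt_add_one C).trans_le <| le_add_of_nonneg_left (hS.nonneg d)

end ModelsRCA0

/-! ### Functions and relations of a model -/

theorem IsRelation.bddDefinable (hS : ModelsRCA0 S) {r : M → M → Prop} (hr : IsRelation S r)
    ⦃s t : (ℕ → M) → M⦄ (hs : TermDefinable s) (ht : TermDefinable t) :
    BddDefinable S fun e => r (s e) (t e) := by
  refine (BddDefinable.mem hr (hs.pair ht)).congr fun e => ⟨?_, fun h => ⟨_, _, h, rfl⟩⟩
  rintro ⟨a, b, hab, h⟩
  obtain ⟨h₁, h₂⟩ := hS.pair_inj.1 h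
  rwa [h₁, h₂]

theorem ModelsRCA0.isRelation (hS : ModelsRCA0 S) {r : M → M → Prop}
    (hr : SigmaDefinable S fun e => r (e 0) (e 1))
    (hr' : SigmaDefinable S fun e => ¬ r (e 0) (e 1)) : IsRelation S r := by
  have hcode {r : M → M → Prop} (hr : SigmaDefinable S fun e => r (e 0) (e 1)) :
      SigmaDefinable S fun e => ∃ a b, r a b ∧ e 0 = pair a b :=
    .ex <| .ex <| (hr.comp fun i => 1 - i).and_bdd .auto
  have hnot : SigmaDefinable S fun e =>
      (∃ a b, ¬ r a b ∧ e 0 = pair a b) ∨ ¬ ∃ a ≤ e 0, ∃ b ≤ e 0, e 0 = pair a b :=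
    (hcode (r := fun a b => ¬ r a b) hr').or (.of_bdd .auto)
  refine hS.mem_of_sigmaDefinable (hcode hr) (hnot.congr fun e => ⟨?_, fun hz => ?_⟩)
  · rintro (⟨a, b, hab, h₀⟩ | hz) ⟨c, d, hcd, h₁⟩
    · obtain ⟨rfl, rfl⟩ := hS.pair_inj.1 (h₀.symm.trans h₁)
      exact hab hcd
    · exact hz ⟨c, h₁ ▸ hS.left_le_pair c d, d, h₁ ▸ hS.right_le_pair c d, h₁⟩
  · by_contra! hcon
    obtain ⟨a, -, b, -, hab⟩ := hcon.2
    exact hcon.1 a b (fun hr => hz ⟨a, b, hr, hab⟩) hab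

theorem BddDefinable.subst₂ (hS : ModelsRCA0 S) {r : M → M → Prop}
    (hr : BddDefinable S fun e => r (e 0) (e 1)) ⦃s t : (ℕ → M) → M⦄
    (hs : TermDefinable s) (ht : TermDefinable t) : BddDefinable S fun e => r (s e) (t e) :=
  (hS.isRelation (.of_bdd hr) (.of_bdd hr.not)).bddDefinable hS hs ht

theorem IsFunction.bddDefinable_eq (hS : ModelsRCA0 S) {f : M → M} (hf : IsFunction S f)
    ⦃s t : (ℕ → M) → M⦄ (hs : TermDefinable s) (ht : TermDefinable t) :
    BddDefinable S fun e => f (s e) = t e :=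
  (BddDefinable.mem hf (hs.pair ht)).congr fun e => by
    simp [hS.pair_inj, eq_comm (a := t e)]

theorem IsFunction.bddDefinable_rel_map (hS : ModelsRCA0 S) {f : M → M} (hf : IsFunction S f)
    {r : M → M → Prop} (hr : BddDefinable S fun e => r (e 0) (e 1)) ⦃s t : (ℕ → M) → M⦄
    (hs : TermDefinable s) (ht : TermDefinable t) : BddDefinable S fun e => r (f (s e)) (t e) := by
  have hval := hf.bddDefinable_eq hS
  have hex {r : M → M → Prop} (hr : BddDefinable S fun e => r (e 0) (e 1)) :
      SigmaDefinable S fun e => r (f (e 0)) (e 1) := by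
    have hr' := hr.comp fun i => 2 * i
    exact SigmaDefinable.congr (A := fun e => ∃ u, f (e 0) = u ∧ r u (e 1))
      (.ex <| .of_bdd .auto) fun e => by simp
  exact (hS.isRelation (r := fun n k => r (f n) k) (hex hr)
    (hex (r := fun v k => ¬ r v k) hr.not)).bddDefinable hS hs ht

theorem IsFunction.bddDefinable_map_lt_map (hS : ModelsRCA0 S) {f : M → M} (hf : IsFunction S f)
    ⦃s t : (ℕ → M) → M⦄ (hs : TermDefinable s) (ht : TermDefinable t) :
    BddDefinable S fun e => f (s e) < f (t e) := by
  have hlt := hf.bddDefinable_rel_map hS (r := (· < ·)) .auto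
  exact hf.bddDefinable_rel_map hS (r := fun v n => f n < v) .auto ht hs

theorem IsFunction.exists_gt_le_map (hS : ModelsRCA0 S) {f : M → M} (hf : IsFunction S f)
    (hinj : Function.Injective f) (i b : M) : ∃ j > i, b ≤ f j := by
  have hval := hf.bddDefinable_eq hS
  obtain ⟨j, hj⟩ := hS.exists_le_map (g := fun j => f (i + 1 + j)) .auto
    (fun j k h => add_left_cancel (hinj h)) b
  exact ⟨i + 1 + j, (lt_add_one i).trans_le (le_add_of_nonneg_right (hS.nonneg j)), hj⟩

end SOA

namespace SOA

/-! ### True numbers -/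

section

variable {M : Type*} [LinearOrder M] {f : M → M} {i m n : M}

theorem trueAt_trans (h : i ∈ trueAt f m) (h' : m ∈ trueAt f n) : i ∈ trueAt f n := by
  refine ⟨h.1.trans h'.1, fun k hik hkn => ?_⟩
  rcases le_or_gt k m with hkm | hmk
  · exact h.2 k hik hkm
  · exact (h.2 m h.1 le_rfl).trans (h'.2 k hmk hkn)

theorem trueAt_of_le (h : i ∈ trueAt f n) (him : i < m) (hmn : m ≤ n) : i ∈ trueAt f m :=
  ⟨him, fun k hik hkm => h.2 k hik (hkm.trans hmn)⟩

/-- `a` is `f`-true: it is true at every later stage. -/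
def IsTrueNumber (f : M → M) (a : M) : Prop := ∀ l, a < l → f a < f l

end

variable {M : Type*} [CommSemiring M] [LinearOrder M] [IsStrictOrderedRing M] {S : Set (Set M)}
  {f : M → M}

theorem IsFunction.bddDefinable_trueAt (hS : ModelsRCA0 S) (hf : IsFunction S f)
    ⦃s t : (ℕ → M) → M⦄ (hs : TermDefinable s) (ht : TermDefinable t) :
    BddDefinable S fun e => s e ∈ trueAt f (t e) := by
  have hlt := hf.bddDefinable_map_lt_map hS
  refine BddDefinable.subst₂ hS (r := fun n s => n ∈ trueAt f s) ?_ hs ht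
  refine BddDefinable.congr (A := fun e => e 0 < e 1 ∧ ∀ k ≤ e 1, e 0 < k → f (e 0) < f k)
    .auto fun e => ?_
  exact and_congr_right' (forall_congr' fun k => forall_comm)

theorem IsFunction.trueAt_succ_cases (hS : ModelsRCA0 S) (hf : IsFunction S f) (s : M) :
    (∃ n₀, trueAt f (s + 1) ⊂ trueAt f s ∪ {s} ∧
      IsLeast ((trueAt f s ∪ {s}) \ trueAt f (s + 1)) n₀) ∨
    trueAt f (s + 1) = trueAt f s ∪ {s} := by
  have htrue := hf.bddDefinable_trueAt hS
  have hsub : trueAt f (s + 1) ⊆ trueAt f s ∪ {s} := fun n hn =>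
    (hS.lt_add_one_iff.1 hn.1).lt_or_eq.imp (trueAt_of_le hn · (lt_add_one s).le) id
  refine hsub.ssubset_or_eq.imp_left fun h => ?_
  obtain ⟨n₀, h₀⟩ := hS.exists_isLeast
    (A := fun n => (n ∈ trueAt f s ∨ n = s) ∧ ¬ n ∈ trueAt f (s + 1)) (.of_bdd .auto)
    (Set.exists_of_ssubset h)
  exact ⟨n₀, h, h₀⟩

theorem IsFunction.exists_isTrueNumber_ge (hS : ModelsRCA0 S) (hf : IsFunction S f)
    (hinj : Function.Injective f) (b : M) : ∃ a ≥ b, IsTrueNumber f a := by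
  have hval := hf.bddDefinable_eq hS
  obtain ⟨_, ⟨a, hba, rfl⟩, hmin⟩ := hS.exists_isLeast (A := fun v => ∃ a, b ≤ a ∧ f a = v)
    (.ex <| .of_bdd .auto) ⟨f b, b, le_rfl, rfl⟩
  exact ⟨a, hba, fun l hal => (hmin ⟨l, hba.trans hal.le, rfl⟩).lt_of_ne (hinj.ne hal.ne)⟩

-- A value `n < f a` with `a` true can only be attained at some `m ≤ a`.
theorem IsFunction.range_mem_of_isTrueNumber (hS : ModelsRCA0 S) (hf : IsFunction S f)
    {A : M → Prop} (hA : SigmaDefinable S fun e => A (e 0)) (htrue : ∀ a, A a → IsTrueNumber f a)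
    (hunb : ∀ b, ∃ a ≥ b, A a) : {n | ∃ m, f m = n} ∈ S := by
  have hval := hf.bddDefinable_eq hS
  have hgt := hf.bddDefinable_rel_map hS (r := fun v n => n < v) .auto
  have hlarge (k : M) : ∃ a, A a ∧ k ≤ f a := by
    have hge := hf.bddDefinable_rel_map hS (r := fun v n => n ≤ v) .auto
    have hA' := hA.comp fun _ => 0
    induction k using hS.induct with
    | hA => exact .ex <| hA'.and_bdd .auto
    | zero =>
      obtain ⟨a, -, ha⟩ := hunb 0
      exact ⟨a, ha, hS.nonneg _⟩
    | succ k ih =>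
      obtain ⟨a, ha, hk⟩ := ih
      obtain ⟨b, hab, hb⟩ := hunb (a + 1)
      exact ⟨b, hb, (hS.discrete _ _).1 <|
        hk.trans_lt (htrue a ha b ((lt_add_one a).trans_le hab))⟩
  refine hS.mem_of_sigmaDefinable (.ex <| .of_bdd .auto) ?_
  have hcompl : SigmaDefinable S fun e =>
      ∃ a, A a ∧ e 0 < f a ∧ ∀ m ≤ a, ¬ f m = e 0 := .ex <| hA.and_bdd .auto
  refine hcompl.congr fun e => ⟨?_, fun hn => ?_⟩
  · rintro ⟨a, ha, hlt, hne⟩ ⟨m, hm⟩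
    rcases le_or_gt m a with hma | ham
    · exact hne m hma hm
    · exact hlt.not_gt (hm ▸ htrue a ha m ham)
  · obtain ⟨a, ha, hle⟩ := hlarge (e 0 + 1)
    exact ⟨a, ha, (hS.discrete _ _).2 hle, fun m _ hm => hn ⟨m, hm⟩⟩

end SOA

namespace SOA

/-! ### Placing a new copy -/

section

variable {M : Type*} {le le' : M → M → Prop} {D Z : Set M} {w : M}

theorem placedAbove_iff : PlacedAbove le D Z w ↔
    ∀ y ∈ D, ∀ z ∈ Z, (le y z ↔ le y w) ∧ (le z y ↔ Lt le w y) := by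
  unfold PlacedAbove Lt Incomp
  refine forall₂_congr fun y _ => forall₂_congr fun z _ => ?_
  tauto

theorem placedBelow_iff_placedAbove_flip :
    PlacedBelow le D Z w ↔ PlacedAbove (flip le) D Z w := by
  unfold PlacedBelow PlacedAbove Lt Incomp flip
  refine forall₂_congr fun y _ => forall₂_congr fun z _ => ?_
  tauto

theorem placedBelow_iff : PlacedBelow le D Z w ↔
    ∀ y ∈ D, ∀ z ∈ Z, (le y z ↔ Lt le y w) ∧ (le z y ↔ le w y) := by
  rw [placedBelow_iff_placedAbove_flip, placedAbove_iff]
  exact forall₂_congr fun y _ => forall₂_congr fun z _ => and_comm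

theorem PlacedAbove.trans_union (h : PlacedAbove le D Z w) (hw : w ∈ D)
    (hD : ∀ a ∈ D, ∀ b ∈ D, ∀ c ∈ D, le a b → le b c → le a c)
    (hZ : ∀ a ∈ Z, ∀ b ∈ Z, ∀ c ∈ Z, le a b → le b c → le a c) :
    ∀ a ∈ D ∪ Z, ∀ b ∈ D ∪ Z, ∀ c ∈ D ∪ Z, le a b → le b c → le a c := by
  rw [placedAbove_iff] at h
  rintro a (ha | ha) b (hb | hb) c (hc | hc) hab hbc
  · exact hD a ha b hb c hc hab hbc
  · exact (h a ha c hc).1.2 (hD a ha b hb w hw hab ((h b hb c hc).1.1 hbc))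
  · exact hD a ha w hw c hc ((h a ha b hb).1.1 hab) ((h c hc b hb).2.1 hbc).1
  · exact (h a ha c hc).1.2 ((h a ha b hb).1.1 hab)
  · obtain ⟨hwb, hbw⟩ := (h b hb a ha).2.1 hab
    exact (h c hc a ha).2.2 ⟨hD w hw b hb c hc hwb hbc, fun hcw => hbw (hD b hb c hc w hw hbc hcw)⟩
  · exact absurd ((h b hb c hc).1.1 hbc) ((h b hb a ha).2.1 hab).2
  · exact (h c hc a ha).2.2 ((h c hc b hb).2.1 hbc)
  · exact hZ a ha b hb c hc hab hbc

theorem PlacedBelow.trans_union (h : PlacedBelow le D Z w) (hw : w ∈ D)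
    (hD : ∀ a ∈ D, ∀ b ∈ D, ∀ c ∈ D, le a b → le b c → le a c)
    (hZ : ∀ a ∈ Z, ∀ b ∈ Z, ∀ c ∈ Z, le a b → le b c → le a c) :
    ∀ a ∈ D ∪ Z, ∀ b ∈ D ∪ Z, ∀ c ∈ D ∪ Z, le a b → le b c → le a c :=
  fun a ha b hb c hc hab hbc =>
    (placedBelow_iff_placedAbove_flip.1 h).trans_union hw
      (fun a ha b hb c hc hba hcb => hD c hc b hb a ha hcb hba)
      (fun a ha b hb c hc hba hcb => hZ c hc b hb a ha hcb hba) c hc b hb a ha hbc hab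

theorem PlacedAbove.antisymm_union (h : PlacedAbove le D Z w)
    (hD : ∀ a ∈ D, ∀ b ∈ D, le a b → le b a → a = b)
    (hZ : ∀ a ∈ Z, ∀ b ∈ Z, le a b → le b a → a = b) :
    ∀ a ∈ D ∪ Z, ∀ b ∈ D ∪ Z, le a b → le b a → a = b := by
  rw [placedAbove_iff] at h
  rintro a (ha | ha) b (hb | hb) hab hba
  · exact hD a ha b hb hab hba
  · exact absurd ((h a ha b hb).1.1 hab) ((h a ha b hb).2.1 hba).2
  · exact absurd ((h b hb a ha).1.1 hba) ((h b hb a ha).2.1 hab).2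
  · exact hZ a ha b hb hab hba

theorem PlacedBelow.antisymm_union (h : PlacedBelow le D Z w)
    (hD : ∀ a ∈ D, ∀ b ∈ D, le a b → le b a → a = b)
    (hZ : ∀ a ∈ Z, ∀ b ∈ Z, le a b → le b a → a = b) :
    ∀ a ∈ D ∪ Z, ∀ b ∈ D ∪ Z, le a b → le b a → a = b :=
  fun a ha b hb hab hba => (placedBelow_iff_placedAbove_flip.1 h).antisymm_union
    (fun a ha b hb hba hab => hD a ha b hb hab hba)
    (fun a ha b hb hba hab => hZ a ha b hb hab hba) a ha b hb hba hab

theorem PlacedAbove.congr_union (h : PlacedAbove le D Z w) (h' : PlacedAbove le' D Z w)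
    (hw : w ∈ D) (hD : ∀ a ∈ D, ∀ b ∈ D, le a b ↔ le' a b)
    (hZ : ∀ a ∈ Z, ∀ b ∈ Z, le a b ↔ le' a b) :
    ∀ a ∈ D ∪ Z, ∀ b ∈ D ∪ Z, le a b ↔ le' a b := by
  rw [placedAbove_iff] at h h'
  have hcross (y : M) (hy : y ∈ D) (z : M) (hz : z ∈ Z) :
      (le y z ↔ le' y z) ∧ (le z y ↔ le' z y) := by
    simp only [h y hy z hz, h' y hy z hz, Lt, hD y hy w hw, hD w hw y hy, and_self]
  rintro a (ha | ha) b (hb | hb)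
  exacts [hD a ha b hb, (hcross a ha b hb).1, (hcross b hb a ha).2, hZ a ha b hb]

theorem PlacedBelow.congr_union (h : PlacedBelow le D Z w) (h' : PlacedBelow le' D Z w)
    (hw : w ∈ D) (hD : ∀ a ∈ D, ∀ b ∈ D, le a b ↔ le' a b)
    (hZ : ∀ a ∈ Z, ∀ b ∈ Z, le a b ↔ le' a b) :
    ∀ a ∈ D ∪ Z, ∀ b ∈ D ∪ Z, le a b ↔ le' a b :=
  fun a ha b hb => (placedBelow_iff_placedAbove_flip.1 h).congr_union
    (placedBelow_iff_placedAbove_flip.1 h') hw (fun a ha b hb => hD b hb a ha)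
    (fun a ha b hb => hZ b hb a ha) b hb a ha

end

variable {M : Type*} [CommSemiring M] [LinearOrder M] [IsStrictOrderedRing M] {S : Set (Set M)}
  {P : Set M}

/-! ### Copies of `P` -/

theorem copiesUpTo_zero (hS : ModelsRCA0 S) : copiesUpTo P 0 = copy P 0 := by
  ext z
  refine ⟨?_, fun hz => ⟨0, le_rfl, hz⟩⟩
  rintro ⟨n, hn, hz⟩
  rwa [le_antisymm hn (hS.nonneg n)] at hz

theorem copiesUpTo_add_one (hS : ModelsRCA0 S) (s : M) :
    copiesUpTo P (s + 1) = copiesUpTo P s ∪ copy P (s + 1) := by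
  ext z
  constructor
  · rintro ⟨n, hn, hz⟩
    rcases hn.lt_or_eq with h | rfl
    exacts [.inl ⟨n, hS.lt_add_one_iff.1 h, hz⟩, .inr hz]
  · rintro (⟨n, hn, hz⟩ | hz)
    exacts [⟨n, hn.trans (lt_add_one s).le, hz⟩, ⟨_, le_rfl, hz⟩]

theorem IsFinite.exists_le_pair_of_mem_copiesUpTo (hS : ModelsRCA0 S) (hfin : IsFinite P) :
    ∃ k, ∀ s, ∀ z ∈ copiesUpTo P s, z ≤ pair s k := by
  obtain ⟨k, hk⟩ := hfin
  refine ⟨k, fun s z ⟨n, hn, p, hp, hz⟩ => ?_⟩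
  exact hz ▸ hS.pair_le_pair hn (hk p hp).le

theorem BddDefinable.ball_copiesUpTo (hS : ModelsRCA0 S) (hP : P ∈ S) (hfin : IsFinite P)
    ⦃t : (ℕ → M) → M⦄ ⦃A : M → (ℕ → M) → Prop⦄ (ht : TermDefinable t)
    (hA : BddDefinable S fun e => A (e 0) fun i => e (i + 1)) :
    BddDefinable S fun e => ∀ a ∈ copiesUpTo P (t e), A a e := by
  obtain ⟨k, hk⟩ := hfin.exists_le_pair_of_mem_copiesUpTo hS
  have ht' := ht.comp (· + 1)
  refine congr (A := fun e => ∀ a ≤ pair (t e) k,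
    (∃ n ≤ t e, ∃ p ≤ a, p ∈ P ∧ a = pair n p) → A a e) .auto fun e => ?_
  constructor
  · rintro h a ⟨n, hn, p, hp, rfl⟩
    exact h _ (hk _ _ ⟨n, hn, p, hp, rfl⟩) ⟨n, hn, p, hS.right_le_pair n p, hp, rfl⟩
  · rintro h a - ⟨n, hn, p, -, hp, rfl⟩
    exact h _ ⟨n, hn, p, hp, rfl⟩

end SOA

namespace SOA

/-! ### Uniqueness of `Ξ_f(P, x)` and the order axioms -/

namespace IsXi

variable {M : Type*} [CommSemiring M] [LinearOrder M] {S : Set (Set M)} {f : M → M}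
  {P : Set M} {leP : M → M → Prop} {x : M} {Q : Set M} {leQ : M → M → Prop}

theorem eventually_mem_copiesUpTo (h : IsXi S f P leP x Q leQ) {a : M} (ha : a ∈ Q) :
    ∀ᶠ s in Filter.atTop, a ∈ copiesUpTo P s := by
  obtain ⟨n, hn⟩ := (h.domain a).1 ha
  exact (Filter.eventually_ge_atTop n).mono fun s hs => ⟨n, hs, hn⟩

theorem trans_copy (h : IsXi S f P leP x Q leQ) (hP : IsQuasiOrder S P leP) (n : M) :
    ∀ a ∈ copy P n, ∀ b ∈ copy P n, ∀ c ∈ copy P n, leQ a b → leQ b c → leQ a c := by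
  rintro _ ⟨p, hp, rfl⟩ _ ⟨q, hq, rfl⟩ _ ⟨r, hr, rfl⟩
  rw [h.onCopy n p hp q hq, h.onCopy n q hq r hr, h.onCopy n p hp r hr]
  exact hP.trans p q r

theorem antisymm_copy (h : IsXi S f P leP x Q leQ) (hP : IsPartialOrder S P leP) (n : M) :
    ∀ a ∈ copy P n, ∀ b ∈ copy P n, leQ a b → leQ b a → a = b := by
  rintro _ ⟨p, hp, rfl⟩ _ ⟨q, hq, rfl⟩
  rw [h.onCopy n p hp q hq, h.onCopy n q hq p hp]
  exact fun hpq hqp => by rw [hP.antisymm p q hpq hqp]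

theorem congr_copy {Q' : Set M} {leQ' : M → M → Prop} (h : IsXi S f P leP x Q leQ)
    (h' : IsXi S f P leP x Q' leQ') (n : M) :
    ∀ a ∈ copy P n, ∀ b ∈ copy P n, leQ a b ↔ leQ' a b := by
  rintro _ ⟨p, hp, rfl⟩ _ ⟨q, hq, rfl⟩
  rw [h.onCopy n p hp q hq, h'.onCopy n p hp q hq]

variable [IsStrictOrderedRing M]

theorem placed_cases (hS : ModelsRCA0 S) (hf : IsFunction S f) (hx : x ∈ P) (s : M) :
    ∃ w ∈ copiesUpTo P s,
      (∀ leP Q leQ, IsXi S f P leP x Q leQ →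
        PlacedAbove leQ (copiesUpTo P s) (copy P (s + 1)) w) ∨
      (∀ leP Q leQ, IsXi S f P leP x Q leQ →
        PlacedBelow leQ (copiesUpTo P s) (copy P (s + 1)) w) := by
  rcases hf.trueAt_succ_cases hS s with ⟨n₀, hss, h₀⟩ | heq
  · have hn₀s : n₀ ≤ s := h₀.1.1.elim (·.1.le) le_of_eq
    exact ⟨pair n₀ x, ⟨n₀, hn₀s, x, hx, rfl⟩, .inl fun _ _ _ h => h.above s n₀ hss h₀⟩
  · exact ⟨pair s x, ⟨s, le_rfl, x, hx, rfl⟩, .inr fun _ _ _ h => h.below s heq⟩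

theorem trans_copiesUpTo (hS : ModelsRCA0 S) (hf : IsFunction S f) (hP : IsQuasiOrder S P leP)
    (hfin : IsFinite P) (hx : x ∈ P) (h : IsXi S f P leP x Q leQ) (s : M) :
    ∀ a ∈ copiesUpTo P s, ∀ b ∈ copiesUpTo P s, ∀ c ∈ copiesUpTo P s,
      leQ a b → leQ b c → leQ a c := by
  have hball := BddDefinable.ball_copiesUpTo hS hP.mem hfin
  have hle := h.isRelation.bddDefinable hS
  induction s using hS.induct with
  | hA => exact .of_bdd .auto
  | zero => simpa only [copiesUpTo_zero hS] using h.trans_copy hP 0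
  | succ s ih =>
    simp only [copiesUpTo_add_one hS]
    obtain ⟨w, hw, hplaced | hplaced⟩ := placed_cases hS hf hx s
    · exact (hplaced _ _ _ h).trans_union hw ih (h.trans_copy hP (s + 1))
    · exact (hplaced _ _ _ h).trans_union hw ih (h.trans_copy hP (s + 1))

theorem antisymm_copiesUpTo (hS : ModelsRCA0 S) (hf : IsFunction S f)
    (hP : IsPartialOrder S P leP) (hfin : IsFinite P) (hx : x ∈ P) (h : IsXi S f P leP x Q leQ)
    (s : M) : ∀ a ∈ copiesUpTo P s, ∀ b ∈ copiesUpTo P s, leQ a b → leQ b a → a = b := by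
  have hball := BddDefinable.ball_copiesUpTo hS hP.mem hfin
  have hle := h.isRelation.bddDefinable hS
  induction s using hS.induct with
  | hA => exact .of_bdd .auto
  | zero => simpa only [copiesUpTo_zero hS] using h.antisymm_copy hP 0
  | succ s ih =>
    simp only [copiesUpTo_add_one hS]
    obtain ⟨w, -, hplaced | hplaced⟩ := placed_cases hS hf hx s
    · exact (hplaced _ _ _ h).antisymm_union ih (h.antisymm_copy hP (s + 1))
    · exact (hplaced _ _ _ h).antisymm_union ih (h.antisymm_copy hP (s + 1))

theorem congr_copiesUpTo (hS : ModelsRCA0 S) (hf : IsFunction S f) (hP : P ∈ S)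
    (hfin : IsFinite P) (hx : x ∈ P) {Q' : Set M} {leQ' : M → M → Prop}
    (h : IsXi S f P leP x Q leQ) (h' : IsXi S f P leP x Q' leQ') (s : M) :
    ∀ a ∈ copiesUpTo P s, ∀ b ∈ copiesUpTo P s, leQ a b ↔ leQ' a b := by
  have hball := BddDefinable.ball_copiesUpTo hS hP hfin
  have hle := h.isRelation.bddDefinable hS
  have hle' := h'.isRelation.bddDefinable hS
  induction s using hS.induct with
  | hA => exact .of_bdd .auto
  | zero => simpa only [copiesUpTo_zero hS] using h.congr_copy h' 0
  | succ s ih =>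
    simp only [copiesUpTo_add_one hS]
    obtain ⟨w, hw, hplaced | hplaced⟩ := placed_cases hS hf hx s
    · exact (hplaced _ _ _ h).congr_union (hplaced _ _ _ h') hw ih (h.congr_copy h' (s + 1))
    · exact (hplaced _ _ _ h).congr_union (hplaced _ _ _ h') hw ih (h.congr_copy h' (s + 1))

theorem isQuasiOrder (hS : ModelsRCA0 S) (hf : IsFunction S f) (hP : IsQuasiOrder S P leP)
    (hfin : IsFinite P) (hx : x ∈ P) (h : IsXi S f P leP x Q leQ) : IsQuasiOrder S Q leQ where
  mem := h.mem
  isRelation := h.isRelation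
  supp := h.supp
  refl a ha := by
    obtain ⟨n, p, hp, rfl⟩ := (h.domain a).1 ha
    exact (h.onCopy n p hp p hp).2 (hP.refl p hp)
  trans a b c hab hbc := by
    obtain ⟨s, ha, hb, hc⟩ := ((h.eventually_mem_copiesUpTo (h.supp a b hab).1).and <|
      (h.eventually_mem_copiesUpTo (h.supp b c hbc).1).and <|
      h.eventually_mem_copiesUpTo (h.supp b c hbc).2).exists
    exact trans_copiesUpTo hS hf hP hfin hx h s a ha b hb c hc hab hbc

theorem isPartialOrder (hS : ModelsRCA0 S) (hf : IsFunction S f) (hP : IsPartialOrder S P leP)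
    (hfin : IsFinite P) (hx : x ∈ P) (h : IsXi S f P leP x Q leQ) : IsPartialOrder S Q leQ where
  toIsQuasiOrder := h.isQuasiOrder hS hf hP.toIsQuasiOrder hfin hx
  antisymm a b hab hba := by
    obtain ⟨s, ha, hb⟩ := ((h.eventually_mem_copiesUpTo (h.supp a b hab).1).and <|
      h.eventually_mem_copiesUpTo (h.supp a b hab).2).exists
    exact antisymm_copiesUpTo hS hf hP hfin hx h s a ha b hb hab hba

theorem unique (hS : ModelsRCA0 S) (hf : IsFunction S f) (hP : P ∈ S) (hfin : IsFinite P)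
    (hx : x ∈ P) {Q' : Set M} {leQ' : M → M → Prop} (h : IsXi S f P leP x Q leQ)
    (h' : IsXi S f P leP x Q' leQ') : Q' = Q ∧ leQ' = leQ := by
  obtain rfl : Q' = Q := Set.ext fun z => (h'.domain z).trans (h.domain z).symm
  refine ⟨rfl, funext₂ fun a b => propext ?_⟩
  by_cases hab : a ∈ Q' ∧ b ∈ Q'
  · obtain ⟨s, ha, hb⟩ := ((h.eventually_mem_copiesUpTo hab.1).and <|
      h.eventually_mem_copiesUpTo hab.2).exists
    exact congr_copiesUpTo hS hf hP hfin hx h' h s a ha b hb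
  · exact iff_of_false (fun hle => hab (h'.supp a b hle)) (fun hle => hab (h.supp a b hle))

end IsXi

end SOA

namespace SOA

/-! ### Existence of `Ξ_f(P, x)` -/

section

variable {M : Type*} [LinearOrder M] {f : M → M} {leP : M → M → Prop} {x m n p w : M}

theorem trueAt_subset_of_mem (h : m ∈ trueAt f n) : trueAt f m ⊆ trueAt f n :=
  fun _ hi => trueAt_trans hi h

theorem mem_trueAt_congr (h : trueAt f m ⊆ trueAt f n) (hmn : m ≤ n) {i : M} (hi : i < m) :
    i ∈ trueAt f m ↔ i ∈ trueAt f n :=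
  ⟨fun hm => h hm, fun hn => trueAt_of_le hn hi hmn⟩

theorem trueAt_subset_congr (h : trueAt f w ⊆ trueAt f n) (hwn : w ≤ n) (hmw : m < w) :
    trueAt f m ⊆ trueAt f w ↔ trueAt f m ⊆ trueAt f n :=
  forall₂_congr fun _ hi => mem_trueAt_congr h hwn (hi.1.trans hmw)

/-- The element `p` of the `m`-th copy lies below the later `n`-th copy. With respect to the
`m`-th copy, the `n`-th one is placed immediately below `x_m` if `m` is true at `n`, immediately
above `x_m` if `m` is false at `n` but all numbers true at `m` are true at `n`, and on top
otherwise. -/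
def LeLater (f : M → M) (leP : M → M → Prop) (x m p n : M) : Prop :=
  trueAt f m ⊆ trueAt f n → leP p x ∧ (m ∈ trueAt f n → ¬ leP x p)

/-- The element `p` of the `m`-th copy lies above the later `n`-th copy; see `LeLater`. -/
def GeLater (f : M → M) (leP : M → M → Prop) (x m p n : M) : Prop :=
  trueAt f m ⊆ trueAt f n ∧ leP x p ∧ (¬ m ∈ trueAt f n → ¬ leP p x)

theorem GeLater.not_leLater (h : GeLater f leP x m p n) : ¬ LeLater f leP x m p n := by
  unfold LeLater
  unfold GeLater at h
  tauto

theorem leLater_iff_of_mem (h : m ∈ trueAt f n) : LeLater f leP x m p n ↔ Lt leP p x := by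
  simp only [LeLater, h, trueAt_subset_of_mem h, Lt, true_imp_iff]

theorem geLater_iff_of_mem (h : m ∈ trueAt f n) : GeLater f leP x m p n ↔ leP x p := by
  simp only [GeLater, h, trueAt_subset_of_mem h, true_and, not_true, false_imp_iff, and_true]

theorem leLater_iff_of_notMem (h : m ∉ trueAt f n) (hsub : trueAt f m ⊆ trueAt f n) :
    LeLater f leP x m p n ↔ leP p x := by
  simp only [LeLater, h, hsub, true_imp_iff, false_imp_iff, and_true]

theorem geLater_iff_of_notMem (h : m ∉ trueAt f n) (hsub : trueAt f m ⊆ trueAt f n) :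
    GeLater f leP x m p n ↔ Lt leP x p := by
  simp only [GeLater, h, hsub, Lt, true_and, not_false_iff, true_imp_iff]

theorem leLater_of_not_subset (h : ¬ trueAt f m ⊆ trueAt f n) : LeLater f leP x m p n :=
  fun hsub => absurd hsub h

theorem leLater_congr (h : trueAt f w ⊆ trueAt f n) (hwn : w ≤ n) (hmw : m < w) :
    LeLater f leP x m p w ↔ LeLater f leP x m p n := by
  rw [LeLater, LeLater, trueAt_subset_congr h hwn hmw, mem_trueAt_congr h hwn hmw]

theorem geLater_congr (h : trueAt f w ⊆ trueAt f n) (hwn : w ≤ n) (hmw : m < w) :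
    GeLater f leP x m p w ↔ GeLater f leP x m p n := by
  rw [GeLater, GeLater, trueAt_subset_congr h hwn hmw, mem_trueAt_congr h hwn hmw]

end

section

variable {M : Type*} [LinearOrder M]

/-- The element `p` of the `m`-th copy lies below the element `q` of the `n`-th copy. -/
def XiRel (f : M → M) (leP : M → M → Prop) (x m p n q : M) : Prop :=
  (m = n ∧ leP p q) ∨ (m < n ∧ LeLater f leP x m p n) ∨ (n < m ∧ GeLater f leP x n q m)

/-- The order of `Ξ_f(P, x)`. -/
def XiLe [CommSemiring M] (f : M → M) (P : Set M) (leP : M → M → Prop) (x a b : M) : Prop :=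
  ∃ m p n q, (p ∈ P ∧ q ∈ P) ∧ (a = pair m p ∧ b = pair n q) ∧ XiRel f leP x m p n q

end

variable {M : Type*} [CommSemiring M] [LinearOrder M] [IsStrictOrderedRing M] {S : Set (Set M)}
  {f : M → M} {P : Set M} {leP : M → M → Prop} {x m p n q s n₀ : M}

theorem xiLe_pair_iff (hS : ModelsRCA0 S) (hp : p ∈ P) (hq : q ∈ P) :
    XiLe f P leP x (pair m p) (pair n q) ↔ XiRel f leP x m p n q := by
  refine ⟨?_, fun h => ⟨m, p, n, q, ⟨hp, hq⟩, ⟨rfl, rfl⟩, h⟩⟩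
  rintro ⟨_, _, _, _, -, ⟨h₁, h₂⟩, h⟩
  obtain ⟨rfl, rfl⟩ := hS.pair_inj.1 h₁
  obtain ⟨rfl, rfl⟩ := hS.pair_inj.1 h₂
  exact h

theorem xiLe_pair_self (hS : ModelsRCA0 S) (hp : p ∈ P) (hq : q ∈ P) :
    XiLe f P leP x (pair n p) (pair n q) ↔ leP p q := by
  simp [xiLe_pair_iff hS hp hq, XiRel]

theorem xiLe_pair_of_lt (hS : ModelsRCA0 S) (hp : p ∈ P) (hq : q ∈ P) (h : m < n) :
    XiLe f P leP x (pair m p) (pair n q) ↔ LeLater f leP x m p n := by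
  simp [xiLe_pair_iff hS hp hq, XiRel, h, h.ne, h.not_gt]

theorem xiLe_pair_of_gt (hS : ModelsRCA0 S) (hp : p ∈ P) (hq : q ∈ P) (h : m < n) :
    XiLe f P leP x (pair n q) (pair m p) ↔ GeLater f leP x m p n := by
  simp [xiLe_pair_iff hS hq hp, XiRel, h, h.ne', h.not_gt]

theorem isRelation_xiLe (hS : ModelsRCA0 S) (hf : IsFunction S f) (hP : P ∈ S)
    (hleP : IsRelation S leP) : IsRelation S (XiLe f P leP x) := by
  have htrue := hf.bddDefinable_trueAt hS
  have hle := hleP.bddDefinable hS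
  have hsub (i j : ℕ) : BddDefinable S fun e => trueAt f (e i) ⊆ trueAt f (e j) :=
    BddDefinable.congr (A := fun e => ∀ a < e i, a ∈ trueAt f (e i) → a ∈ trueAt f (e j))
      .auto fun e => forall_congr' fun a => ⟨fun h ha => h ha.1 ha, fun h _ => h⟩
  have hrel (i j k l : ℕ) : BddDefinable S fun e => XiRel f leP x (e i) (e j) (e k) (e l) := by
    unfold XiRel LeLater GeLater
    exact .auto
  have hxi : BddDefinable S fun e => XiLe f P leP x (e 0) (e 1) := by
    refine BddDefinable.congr (A := fun e => ∃ m ≤ e 0, ∃ p ≤ e 0, ∃ n ≤ e 1, ∃ q ≤ e 1,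
      (p ∈ P ∧ q ∈ P) ∧ (e 0 = pair m p ∧ e 1 = pair n q) ∧ XiRel f leP x m p n q) .auto
      fun e => ⟨fun ⟨m, _, p, _, n, _, q, _, h⟩ => ⟨m, p, n, q, h⟩, fun ⟨m, p, n, q, h⟩ => ?_⟩
    obtain ⟨-, ⟨h₀, h₁⟩, -⟩ := id h
    exact ⟨m, h₀ ▸ hS.left_le_pair m p, p, h₀ ▸ hS.right_le_pair m p,
      n, h₁ ▸ hS.left_le_pair n q, q, h₁ ▸ hS.right_le_pair n q, h⟩
  exact hS.isRelation (.of_bdd hxi) (.of_bdd hxi.not)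

theorem placedAbove_xiLe (hS : ModelsRCA0 S) (hx : x ∈ P) (hxx : leP x x)
    (h₀ : IsLeast ((trueAt f s ∪ {s}) \ trueAt f (s + 1)) n₀) :
    PlacedAbove (XiLe f P leP x) (copiesUpTo P s) (copy P (s + 1)) (pair n₀ x) := by
  obtain ⟨⟨hn₀, hn₀'⟩, hmin⟩ := h₀
  have hn₀s : n₀ < s + 1 := hS.lt_add_one_iff.2 (hn₀.elim (·.1.le) le_of_eq)
  have hsub : trueAt f n₀ ⊆ trueAt f (s + 1) := fun i hi => by
    by_contra hi'
    refine hi.1.not_ge (hmin ⟨.inl ?_, hi'⟩)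
    rcases hn₀ with hn₀ | rfl
    exacts [trueAt_trans hi hn₀, hi]
  rw [placedAbove_iff]
  rintro _ ⟨m, hm, p, hp, rfl⟩ _ ⟨q, hq, rfl⟩
  have hms : m < s + 1 := hS.lt_add_one_iff.2 hm
  rw [xiLe_pair_of_lt hS hp hq hms, xiLe_pair_of_gt hS hp hq hms, Lt]
  rcases lt_trichotomy m n₀ with hmn₀ | rfl | hmn₀
  · rw [xiLe_pair_of_lt hS hp hx hmn₀, xiLe_pair_of_gt hS hp hx hmn₀,
      leLater_congr hsub hn₀s.le hmn₀, geLater_congr hsub hn₀s.le hmn₀]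
    exact ⟨.rfl, (and_iff_left_of_imp GeLater.not_leLater).symm⟩
  · rw [leLater_iff_of_notMem hn₀' hsub, geLater_iff_of_notMem hn₀' hsub,
      xiLe_pair_self hS hp hx, xiLe_pair_self hS hx hp]
    exact ⟨.rfl, .rfl⟩
  · have hmem : n₀ ∈ trueAt f m :=
      hn₀.elim (trueAt_of_le · hmn₀ hm) fun h => absurd (h ▸ hmn₀) hm.not_gt
    have hnsub : ¬ trueAt f m ⊆ trueAt f (s + 1) := fun h => hn₀' (h hmem)
    rw [xiLe_pair_of_gt hS hx hp hmn₀, geLater_iff_of_mem hmem]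
    exact ⟨iff_of_true (leLater_of_not_subset hnsub) hxx,
      iff_of_false (fun h => hnsub h.1) fun h => h.2 hxx⟩

theorem placedBelow_xiLe (hS : ModelsRCA0 S) (hx : x ∈ P)
    (h : trueAt f (s + 1) = trueAt f s ∪ {s}) :
    PlacedBelow (XiLe f P leP x) (copiesUpTo P s) (copy P (s + 1)) (pair s x) := by
  have hsub : trueAt f s ⊆ trueAt f (s + 1) := h ▸ Set.subset_union_left
  have hs : s ∈ trueAt f (s + 1) := h ▸ .inr rfl
  rw [placedBelow_iff]
  rintro _ ⟨m, hm, p, hp, rfl⟩ _ ⟨q, hq, rfl⟩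
  have hms : m < s + 1 := hS.lt_add_one_iff.2 hm
  rw [xiLe_pair_of_lt hS hp hq hms, xiLe_pair_of_gt hS hp hq hms, Lt]
  rcases hm.lt_or_eq with hm | rfl
  · rw [xiLe_pair_of_lt hS hp hx hm, xiLe_pair_of_gt hS hp hx hm,
      leLater_congr hsub (lt_add_one s).le hm, geLater_congr hsub (lt_add_one s).le hm]
    exact ⟨(and_iff_left_of_imp fun h h' => h'.not_leLater h).symm, .rfl⟩
  · rw [leLater_iff_of_mem hs, geLater_iff_of_mem hs, xiLe_pair_self hS hp hx,
      xiLe_pair_self hS hx hp]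
    exact ⟨.rfl, .rfl⟩

theorem isXi_xiLe (hS : ModelsRCA0 S) (hf : IsFunction S f) (hP : IsQuasiOrder S P leP)
    (hx : x ∈ P) : IsXi S f P leP x {z | ∃ n, z ∈ copy P n} (XiLe f P leP x) where
  mem := by
    have hPS := hP.mem
    refine hS.mem_of_bddDefinable <| BddDefinable.congr
      (A := fun e => ∃ n ≤ e 0, ∃ p ≤ e 0, p ∈ P ∧ e 0 = pair n p) .auto fun e => ?_
    exact ⟨fun ⟨n, _, p, _, h⟩ => ⟨n, p, h⟩, fun ⟨n, p, hp, h⟩ =>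
      ⟨n, h ▸ hS.left_le_pair n p, p, h ▸ hS.right_le_pair n p, hp, h⟩⟩
  isRelation := isRelation_xiLe hS hf hP.mem hP.isRelation
  supp := by
    rintro _ _ ⟨m, p, n, q, ⟨hp, hq⟩, ⟨rfl, rfl⟩, -⟩
    exact ⟨⟨m, p, hp, rfl⟩, ⟨n, q, hq, rfl⟩⟩
  domain _ := .rfl
  onCopy _ _ hp _ hp' := xiLe_pair_self hS hp hp'
  above _ _ _ h₀ := placedAbove_xiLe hS hx (hP.refl x hx) h₀
  below _ h := placedBelow_xiLe hS hx h

/-! ### Bad sequences -/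

theorem exists_gt_mem_copy (hS : ModelsRCA0 S) (hfin : IsFinite P) {q : M → M}
    (hq : IsFunction S q) (hinj : Function.Injective q) (hqP : ∀ i, ∃ n, q i ∈ copy P n) (i b : M) :
    ∃ j > i, ∃ n > b, q j ∈ copy P n := by
  obtain ⟨k, hk⟩ := hfin.exists_le_pair_of_mem_copiesUpTo hS
  obtain ⟨j, hij, hj⟩ := hq.exists_gt_le_map hS hinj i (pair b k + 1)
  obtain ⟨n, hn⟩ := hqP j
  refine ⟨j, hij, n, lt_of_not_ge fun hnb => ?_, hn⟩
  exact hj.not_gt (hS.lt_add_one_iff.2 (hk b (q j) ⟨n, hnb, hn⟩))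

theorem isTrueNumber_of_bad (hS : ModelsRCA0 S) {q : M → M}
    (hlate : ∀ i b, ∃ j > i, ∃ n > b, q j ∈ copy P n)
    (hbad : ∀ i j, i < j → ¬ XiLe f P leP x (q i) (q j)) {i a : M} (hi : q i ∈ copy P n)
    (ha : a ∈ trueAt f n) : IsTrueNumber f a := by
  by_contra! hfalse
  obtain ⟨l, hal, hfl⟩ : ∃ l, a < l ∧ f l ≤ f a := by simpa [IsTrueNumber] using hfalse
  obtain ⟨j, hij, n', hn', hj⟩ := hlate i (max l n)
  obtain ⟨hln', hnn'⟩ := max_lt_iff.1 hn'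
  refine hbad i j hij ?_
  obtain ⟨⟨p, hp, hqi⟩, p', hp', hqj⟩ := hi, hj
  rw [hqi, hqj, xiLe_pair_of_lt hS hp hp' hnn']
  exact leLater_of_not_subset fun hsub => hfl.not_gt ((hsub ha).2 l hal hln'.le)

theorem range_mem_of_bad (hS : ModelsRCA0 S) (hf : IsFunction S f) (hinj : Function.Injective f)
    (hP : IsQuasiOrder S P leP) (hfin : IsFinite P) {q : M → M} (hq : IsFunction S q)
    (hqP : ∀ i, ∃ n, q i ∈ copy P n) (hbad : ∀ i j, i < j → ¬ XiLe f P leP x (q i) (q j)) :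
    {n | ∃ m, f m = n} ∈ S := by
  have hqinj : Function.Injective q := .of_lt_imp_ne fun i j hij heq => by
    obtain ⟨n, p, hp, hqi⟩ := hqP i
    refine hbad i j hij ?_
    rw [← heq, hqi, xiLe_pair_self hS hp hp]
    exact hP.refl p hp
  have hlate := exists_gt_mem_copy hS hfin hq hqinj hqP
  have hPS := hP.mem
  have hval := hq.bddDefinable_eq hS
  have htrue := hf.bddDefinable_trueAt hS
  refine hf.range_mem_of_isTrueNumber hS
    (A := fun a => ∃ i n p, p ∈ P ∧ q i = pair n p ∧ a ∈ trueAt f n)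
    (.ex <| .ex <| .ex <| .of_bdd .auto) ?_ fun b => ?_
  · rintro a ⟨i, n, p, hp, hqi, ha⟩
    exact isTrueNumber_of_bad hS hlate hbad ⟨p, hp, hqi⟩ ha
  · obtain ⟨a, hba, ha⟩ := hf.exists_isTrueNumber_ge hS hinj b
    obtain ⟨j, -, n, han, p, hp, hqj⟩ := hlate 0 a
    exact ⟨a, hba, j, n, p, hp, hqj, han, fun l hal _ => ha l hal⟩

end SOA

/-- Provability in `RCA₀` is rendered as truth in every model `(M, S)` of `RCA₀`; every function,
relation and set below is one of the model. -/
theorem lemma4p3 {M : Type*} [CommSemiring M] [LinearOrder M] [IsStrictOrderedRing M]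
    (S : Set (Set M)) (hS : SOA.ModelsRCA0 S)
    (f : M → M) (hf : SOA.IsFunction S f) (hinj : Function.Injective f)
    (P : Set M) (leP : M → M → Prop) (hP : SOA.IsPartialOrder S P leP) (hfin : SOA.IsFinite P)
    (x : M) (hx : x ∈ P) :
    ∃ (Q : Set M) (leQ : M → M → Prop),
      SOA.IsXi S f P leP x Q leQ ∧
      (∀ (Q' : Set M) (leQ' : M → M → Prop),
        SOA.IsXi S f P leP x Q' leQ' → Q' = Q ∧ leQ' = leQ) ∧
      SOA.IsPartialOrder S Q leQ ∧
      (¬ SOA.IsWQO S Q leQ → {n | ∃ m, f m = n} ∈ S) := by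
  have hXi := SOA.isXi_xiLe hS hf hP.toIsQuasiOrder hx
  have hQ := hXi.isPartialOrder hS hf hP hfin hx
  refine ⟨_, _, hXi, fun Q' leQ' h => hXi.unique hS hf hP.mem hfin hx h, hQ, fun hwqo => ?_⟩
  obtain ⟨q, hq, hqP, hbad⟩ : ∃ q : M → M, SOA.IsFunction S q ∧ (∀ i, ∃ n, q i ∈ SOA.copy P n) ∧
      ∀ i j, i < j → ¬ SOA.XiLe f P leP x (q i) (q j) := by
    by_contra! hgood
    exact hwqo ⟨hQ.toIsQuasiOrder, hgood⟩
  exact SOA.range_mem_of_bad hS hf hinj hP.toIsQuasiOrder hfin hq hqP hbad
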